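/- **Setting.** Let $N,M\ge 1$ and $K\ge 0$ be integers and $\mathcal M=\{0,1,\dots,M\}$. In a time-slotted multi-queue multi-server (MQMS) system with $N$ queues and $K$ servers, the channel state $C(t)$, $t\ge 1$, is a random $N\times K$ matrix with entries in $\mathcal M$ (the set $\mathcal S$ of all such matrices $C_s$ is finite), and $\pi_s=\Pr(C(t)=C_s)$ does not depend on $t$. Let $\mathcal I$ be the set of $N\times K$ matrices with entries in $\{0,1\}$ and at most one $1$ in each column. The arrival vectors $A(t)\in\mathbb Z_{\ge 0}^N$, $t\ge1$, satisfy $E[A_n(t)^2]\le A_{\max}^2<\infty$ for all $n,t$. A server allocation policy chooses in every slot $t\ge 1$ a (random) matrix $I(t)\in\mathcal I$, and the queue lengths evolve by $$X^{T}(t)=\big(X^{T}(t-1)-(C(t)\circledast I(t))\underline 1_K^{T}\big)^+ +A^{T}(t),$$ where $X(0)\in\mathbb Z_{\ge 0}^N$, $E[X_n(0)]<\infty$, $\circledast$ is the entrywise product and $(\cdot)^+$ the entrywise positive part. The system is strongly stable if $\limsup_{t\to\infty}\frac1t\sum_{\tau=0}^{t-1}E[X_n(\tau)]<\infty$ for every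 $n$. Write $\overline{f(t)}=\lim_{t\to\infty}\frac1t\sum_{\tau=1}^t f(\tau)$ and $$h(\alpha)=\sum_{s\in\mathcal S}\pi_s\max_{I\in\mathcal I}\alpha\,(C_s\circledast I)\,\underline 1_K^{T}.$$ Let $\mathcal P\subset\mathbb R^N$ be the stability region polytope, i.e. the convex hull of the rate vectors $R^{(g)}=\big(\sum_s\pi_s(C_s\circledast I^{(g)}_s)\underline 1_K^T\big)^T$ over all maps $g:s\mapsto I^{(g)}_s$ from $\mathcal S$ to $\mathcal I$. A facet of $\mathcal P$ is a nonempty set $\{x\in\mathcal P: a x^T=b\}$ of dimension $\dim\mathcal P-1$, where $a x^T\le b$ holds on $\mathcal P$. Let $V$ be the set of $\alpha\in\mathbb R_+^N$ such that for every $U\subset\{1,\dots,N\}$ for which $\alpha$ is not identically zero on $U$ nor on $U^c$ there are $i\in U$, $j\in U^c$ and nonzero $m,n\in\mathcal M$ with $\alpha_i,\alpha_j\ne0$ and $\alpha_i m=\alpha_j n$. Let $\mathcal W$ be the set of products of $N-1$ elements of $\mathcal M$. **Theorem.** There is a set $\widehat V\subseteq \mathcal W^N$ such that every nonzero $\alpha\in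 V$ equals $q\beta$ for some $q>0$ and $\beta\in\widehat V$; it can be chosen inside $V\setminus\{0\}$. For every such $\widehat V$: 1. $\widehat V$ is finite. 2. If some server allocation policy makes the system strongly stable, then for every $\alpha\in\widehat V$ $$\limsup_{t\to\infty}\frac1t\sum_{\tau=1}^t\alpha E[A(\tau)]^T\le h(\alpha).$$ In particular $\alpha\,\overline{E[A(t)]^{T}}\le h(\alpha)$ if the time average exists, and $\alpha\lambda^T\le h(\alpha)$ if $E[A(t)]=\lambda$ for all $t\ge1$. 3. $\mathcal P=\{x\in\mathbb R_+^N:\ \alpha x^T\le h(\alpha)\text{ for all }\alpha\in\widehat V\}$. 4. If $\mathcal P$ is full dimensional, then every facet of $\mathcal P$ is either $\{x\in\mathcal P: x_n=0\}$ for some $n$ or $\{x\in\mathcal P:\alpha x^T=h(\alpha)\}$ for some $\alpha\in\widehat V$; and for $\alpha\in\mathbb R^N_+\setminus V$ the set $\{x\in\mathcal P:\alpha x^T=h(\alpha)\}$ is not a facet. -/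

import Mathlib

open MeasureTheory Filter Topology
open scoped ENNReal NNReal

namespace MQMS

/-- A channel state: the `N × K` matrix of link capacities, with entries in `{0, …, M}`. -/
abbrev ChannelState (N K M : ℕ) : Type := Fin N → Fin K → Fin (M + 1)

/-- The allocation matrix space: `N × K` matrices with entries in `{0, 1}` and at most a
single `1` in each column. -/
abbrev Alloc (N K : ℕ) : Type :=
  {I : Fin N → Fin K → Fin 2 // ∀ k, ∑ n, (I n k : ℕ) ≤ 1}

/-- The `n`-th entry of the vector `(C_s ⊛ I) 1_Kᵀ`: the number of packets of queue `n` that can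
be served in channel state `s` under the allocation `I`. -/
def service {N K M : ℕ} (s : ChannelState N K M) (I : Alloc N K) (n : Fin N) : ℕ :=
  ∑ k, (s n k : ℕ) * (I.1 n k : ℕ)

/-- The queue length vectors `X(t)`, with
`X(t) = (X(t-1) - (C(t) ⊛ I(t)) 1ᵀ)⁺ + A(t)` for `t ≥ 1`.
(Subtraction of natural numbers is truncated at `0`, so it is the positive part.) -/
def queue {N K M : ℕ} {Ω : Type*} (C : ℕ → Ω → ChannelState N K M)
    (A : ℕ → Ω → Fin N → ℕ) (X₀ : Ω → Fin N → ℕ) (I : ℕ → Ω → Alloc N K) :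
    ℕ → Ω → Fin N → ℕ
  | 0, ω, n => X₀ ω n
  | t + 1, ω, n =>
      (queue C A X₀ I t ω n - service (C (t + 1) ω) (I (t + 1) ω) n) + A (t + 1) ω n

/-- The standing assumptions on the system with channel process `C(t)`, `t ≥ 1`, arrival
process `A(t)`, `t ≥ 1`, and initial queue lengths `X₀`: the channel state has the same law `π`
in every slot, the second moments of the arrivals are bounded uniformly in time, and the initial
queue lengths have finite expectation. No independence is assumed. -/
structure IsSystem {N K M : ℕ} {Ω : Type*} [MeasurableSpace Ω] (μ : Measure Ω)
    (C : ℕ → Ω → ChannelState N K M) (A : ℕ → Ω → Fin N → ℕ) (X₀ : Ω → Fin N → ℕ)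
    (π : ChannelState N K M → ℝ) (Amax : ℝ≥0) : Prop where
  measurable_channel : ∀ t, 1 ≤ t → Measurable (C t)
  channel_law : ∀ t, 1 ≤ t → ∀ s, μ.real {ω | C t ω = s} = π s
  measurable_arrival : ∀ t, 1 ≤ t → Measurable (A t)
  arrival_second_moment : ∀ t, 1 ≤ t → ∀ n,
    ∫⁻ ω, (A t ω n : ℝ≥0∞) ^ 2 ∂μ ≤ (Amax : ℝ≥0∞) ^ 2
  measurable_init : Measurable X₀
  init_mean : ∀ n, ∫⁻ ω, (X₀ ω n : ℝ≥0∞) ∂μ < ⊤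

/-- Strong stability of all queues: `limsup_t (1/t) ∑_{τ=0}^{t-1} E[X_n(τ)] < ∞` for every `n`. -/
def StronglyStable {N : ℕ} {Ω : Type*} [MeasurableSpace Ω] (μ : Measure Ω)
    (X : ℕ → Ω → Fin N → ℕ) : Prop :=
  ∀ n, limsup (fun t : ℕ =>
    (∑ τ ∈ Finset.range t, ∫⁻ ω, (X τ ω n : ℝ≥0∞) ∂μ) / (t : ℝ≥0∞)) atTop < ⊤

/-- Some server allocation policy makes the system strongly stable. A policy enters through the
allocation matrices `I(t)` that it selects; they may depend on the time, on `C(t)` and `X(t-1)`,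
on the whole past and on additional randomness in an arbitrary (measurable) way. -/
def Stabilizable {N K M : ℕ} {Ω : Type*} [MeasurableSpace Ω] (μ : Measure Ω)
    (C : ℕ → Ω → ChannelState N K M) (A : ℕ → Ω → Fin N → ℕ) (X₀ : Ω → Fin N → ℕ) : Prop :=
  ∃ I : ℕ → Ω → Alloc N K, (∀ t, 1 ≤ t → Measurable (I t)) ∧
    StronglyStable μ (queue C A X₀ I)

/-- The mean arrival vector `E[A(t)]`. -/
noncomputable def meanArrival {N : ℕ} {Ω : Type*} [MeasurableSpace Ω] (μ : Measure Ω)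
    (A : ℕ → Ω → Fin N → ℕ) (t : ℕ) (n : Fin N) : ℝ :=
  ∫ ω, (A t ω n : ℝ) ∂μ

/-- The running average `(1/t) ∑_{τ=1}^{t} f(τ)`. -/
noncomputable def runAvg (f : ℕ → ℝ) (t : ℕ) : ℝ :=
  (∑ τ ∈ Finset.Icc 1 t, f τ) / (t : ℝ)

/-- The right-hand side `∑_s π_s max_{I} α (C_s ⊛ I) 1_Kᵀ`. The supremum runs over the
finite nonempty type of allocation matrices, so it is a maximum. -/
noncomputable def maxRate {N K M : ℕ} (π : ChannelState N K M → ℝ) (α : Fin N → ℝ) : ℝ :=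
  ∑ s, π s * ⨆ I : Alloc N K, ∑ n, α n * (service s I n : ℝ)

/-- The average transmission rate vector of the deterministic policy `g`, which maps
channel states to allocation matrices. -/
noncomputable def policyRate {N K M : ℕ} (π : ChannelState N K M → ℝ)
    (g : ChannelState N K M → Alloc N K) (n : Fin N) : ℝ :=
  ∑ s, π s * (service s (g s) n : ℝ)

/-- The polytope of achievable transmission rate vectors (the stability region polytope): the
convex hull of the rate vectors of all deterministic policies. -/
noncomputable def ratePolytope {N K M : ℕ} (π : ChannelState N K M → ℝ) : Set (Fin N → ℝ) :=
  convexHull ℝ (Set.range (policyRate π))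

/-- The dimension of a nonempty set: the dimension of the direction of its affine span, which is
one less than the maximal number of affinely independent points in it. -/
noncomputable def dim {N : ℕ} (P : Set (Fin N → ℝ)) : ℕ :=
  Module.finrank ℝ (vectorSpan ℝ P)

/-- `F` is the face `{x ∈ P | a x = b}` of `P` for some inequality `a x ≤ b` valid on `P`. -/
def IsFace {N : ℕ} (P F : Set (Fin N → ℝ)) : Prop :=
  ∃ (a : Fin N → ℝ) (b : ℝ), (∀ x ∈ P, ∑ n, a n * x n ≤ b) ∧
    F = {x | x ∈ P ∧ ∑ n, a n * x n = b}

/-- A facet of `P`: a (nonempty) face of dimension `dim P - 1`. -/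
def IsFacet {N : ℕ} (P F : Set (Fin N → ℝ)) : Prop :=
  IsFace P F ∧ F.Nonempty ∧ dim F + 1 = dim P

/-- The set `V` of all nonnegative `α` such that, whenever the index set is split into `U` and its
complement with `α` not identically zero on either part, there are `i ∈ U`, `j ∉ U` with
`α_i, α_j ≠ 0` and nonzero `m, n ∈ {0, …, M}` with `α_i m = α_j n`. -/
def V (N M : ℕ) : Set (Fin N → ℝ) :=
  {α | (∀ n, 0 ≤ α n) ∧
    ∀ U : Set (Fin N), (∃ i ∈ U, α i ≠ 0) → (∃ j ∈ Uᶜ, α j ≠ 0) →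
      ∃ i ∈ U, ∃ j ∈ Uᶜ, ∃ m n : ℕ, m ≤ M ∧ n ≤ M ∧ m ≠ 0 ∧ n ≠ 0 ∧ α i ≠ 0 ∧ α j ≠ 0 ∧
        α i * (m : ℝ) = α j * (n : ℝ)}

/-- The set `W` of all products of `N - 1` elements of `{0, …, M}`. -/
def W (N M : ℕ) : Set ℕ :=
  {z | ∃ m : Fin (N - 1) → ℕ, (∀ j, m j ≤ M) ∧ z = ∏ j, m j}

/-- `Vhat` is a set of vectors in `W^N` that produces, by multiplication with positive
scalars, all nonzero vectors of `V`. -/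
structure GeneratesV {N : ℕ} (M : ℕ) (Vhat : Set (Fin N → ℝ)) : Prop where
  subset_W : ∀ β ∈ Vhat, ∀ n, ∃ z ∈ W N M, β n = (z : ℝ)
  cover : ∀ α ∈ V N M, α ≠ 0 → ∃ q : ℝ, 0 < q ∧ ∃ β ∈ Vhat, α = q • β

end MQMS

/-!
The function `h(α) = maxRate π α` is the support function of the polytope `P` on nonnegative
weights, and everything except the stability bound comes from its piecewise linear structure.
For `α ≥ 0` a best allocation gives server `k` to a queue with the largest `α_n c_{nk}`, so it
depends only on the outcomes of the comparisons `α_i m ≤ α_j n` with `m, n ∈ {0, …, M}`. Hence `h`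
agrees on the whole cell of `α`, the closed cone where these comparisons persist, with the linear
function `β ↦ β · r` for the rate vector `r` of one policy (`exists_policy_maxRate_eq`).

If `α ∉ V`, its support splits into two nonzero parts without ties between them, and the part
`α_U` can be rescaled slightly in both directions inside the cell. Two consequences follow.
An extreme point of a bounded slice of a cell lies in `V` (`extremePoints_slice_subset`); by the
Krein–Milman theorem, and since `V` has finitely many vectors up to scaling, `α` is a convex
combination of vectors of `V` in its own cell, where `h` is linear. So the inequalities for `V`
imply those for all `α ≥ 0`, and these describe `P` in the orthant: a separating functional may be
replaced by its positive part because a policy may leave queues unserved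
(`mem_ratePolytope_of_le_maxRate`). Furthermore the face of `α` lies in two independent hyperplanes,
so that it is not a facet (`not_isFacet_of_notMem_V`). The remaining facets are found among the
constraints because this holds for every full-dimensional polyhedron (`IsFacet.exists_tight`).

Vectors of `V` have representatives in `W^N` because ties connect the support: joining the support
tie by tie needs at most `N - 1` ties, each contributing one factor (`exists_scaled_products`).

For stability, `E[α X(t)]` grows in each slot by at least `α E[A(t)] - h(α)`. Boundedness of the
time averages of `E[α X(t)]` only gives `E[α X(t)] = O(t)` directly; but the backlog falls by at
most `h(α)` per slot, so that a backlog of order `t` would persist and make the averages unbounded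
(`limsup_runAvg_le`).
-/

namespace MQMS

/-! ### Cells of weight vectors on which the maximal rate is linear -/

/-- The closed cell of `α`: the vectors `β` that satisfy every comparison
`β_i m ≤ β_j n` with `m, n ∈ {0, …, M}` that holds for `α`. If `M ≥ 1`, the choice `m = 0`,
`n = 1` makes membership include the sign conditions on `β` that hold for `α`. -/
def cell {N : ℕ} (M : ℕ) (α : Fin N → ℝ) : Set (Fin N → ℝ) :=
  {β | ∀ i j, ∀ m n : Fin (M + 1), α i * (m : ℕ) ≤ α j * (n : ℕ) →
    β i * (m : ℕ) ≤ β j * (n : ℕ)}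

lemma self_mem_cell {N M : ℕ} (α : Fin N → ℝ) : α ∈ cell M α := fun _ _ _ _ h => h

lemma cell_trans {N M : ℕ} {α β γ : Fin N → ℝ} (hβ : β ∈ cell M α) (hγ : γ ∈ cell M β) :
    γ ∈ cell M α := fun i j m n h => hγ i j m n (hβ i j m n h)

lemma smul_mem_cell {N M : ℕ} {α β : Fin N → ℝ} {q : ℝ} (hq : 0 ≤ q) (hβ : β ∈ cell M α) :
    q • β ∈ cell M α := by
  intro i j m n h
  simp only [Pi.smul_apply, smul_eq_mul, mul_assoc]
  exact mul_le_mul_of_nonneg_left (hβ i j m n h) hq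

lemma nonneg_of_mem_cell {N M : ℕ} (hM : 1 ≤ M) {α β : Fin N → ℝ} (hα : ∀ n, 0 ≤ α n)
    (hβ : β ∈ cell M α) (n : Fin N) : 0 ≤ β n := by
  simpa using hβ n n 0 ⟨1, by omega⟩ (by simpa using hα n)

lemma convex_cell {N : ℕ} (M : ℕ) (α : Fin N → ℝ) : Convex ℝ (cell M α) := by
  intro β hβ γ hγ a b ha hb _ i j m n h
  have h1 := mul_le_mul_of_nonneg_left (hβ i j m n h) ha
  have h2 := mul_le_mul_of_nonneg_left (hγ i j m n h) hb
  simp only [Pi.add_apply, Pi.smul_apply, smul_eq_mul]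
  linarith

lemma isClosed_cell {N : ℕ} (M : ℕ) (α : Fin N → ℝ) : IsClosed (cell M α) := by
  simp only [cell, Set.ofPred_forall]
  refine isClosed_iInter fun i => isClosed_iInter fun j => isClosed_iInter fun m =>
    isClosed_iInter fun n => isClosed_iInter fun _ => ?_
  exact isClosed_le (by fun_prop) (by fun_prop)

/-- A direction that respects all ties of `β` can be followed, both ways, inside the cell
of `β`. -/
lemma eventually_add_smul_mem_cell {N M : ℕ} {β d : Fin N → ℝ}
    (hd : ∀ i j, ∀ m n : Fin (M + 1), β i * (m : ℕ) = β j * (n : ℕ) →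
      d i * (m : ℕ) = d j * (n : ℕ)) :
    ∀ᶠ ε in 𝓝 (0 : ℝ), β + ε • d ∈ cell M β := by
  simp only [cell, Set.mem_ofPred_eq, eventually_all]
  intro i j m n h
  rcases h.lt_or_eq with h | h
  · have hc : ∀ k : Fin N, ∀ l : ℕ,
        Tendsto (fun ε : ℝ => (β + ε • d) k * (l : ℝ)) (𝓝 0) (𝓝 (β k * l)) := by
      intro k l
      have : Continuous fun ε : ℝ => (β k + ε * d k) * (l : ℝ) := by fun_prop
      simpa using this.tendsto 0
    exact ((hc i m).eventually_lt (hc j n) h).mono fun _ => le_of_lt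
  · refine Eventually.of_forall fun ε => le_of_eq ?_
    have := hd i j m n h
    simp only [Pi.add_apply, Pi.smul_apply, smul_eq_mul]
    linear_combination h + ε * this

lemma exists_pos_add_sub_mem_cell {N M : ℕ} {β d : Fin N → ℝ}
    (hd : ∀ i j, ∀ m n : Fin (M + 1), β i * (m : ℕ) = β j * (n : ℕ) →
      d i * (m : ℕ) = d j * (n : ℕ)) :
    ∃ ε : ℝ, 0 < ε ∧ β + ε • d ∈ cell M β ∧ β - ε • d ∈ cell M β := by
  have h1 := eventually_add_smul_mem_cell hd
  have h2 : ∀ᶠ ε in 𝓝 (0 : ℝ), β + (-ε) • d ∈ cell M β :=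
    (by simpa using (continuous_neg.tendsto (0 : ℝ)) : Tendsto (fun ε : ℝ => -ε) (𝓝 0) (𝓝 0))
      |>.eventually h1
  have h3 : ∀ᶠ ε in 𝓝[>] (0 : ℝ), 0 < ε := eventually_mem_nhdsWithin
  obtain ⟨ε, h3, h1, h2⟩ :=
    (h3.and ((h1.and h2).filter_mono nhdsWithin_le_nhds)).exists
  exact ⟨ε, h3, h1, by simpa [sub_eq_add_neg] using h2⟩

/-- A nonnegative vector outside `V` splits into two nonzero parts without ties between them, so
that the part on `U` respects all ties. -/
lemma exists_indicator_of_notMem_V {N M : ℕ} {β : Fin N → ℝ} (hβ : ∀ n, 0 ≤ β n)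
    (hV : β ∉ V N M) :
    ∃ U : Set (Fin N), (∃ i ∈ U, β i ≠ 0) ∧ (∃ j ∉ U, β j ≠ 0) ∧
      ∀ i j, ∀ m n : Fin (M + 1), β i * (m : ℕ) = β j * (n : ℕ) →
        U.indicator β i * (m : ℕ) = U.indicator β j * (n : ℕ) := by
  classical
  simp only [V, Set.mem_ofPred_eq, not_and, not_forall] at hV
  obtain ⟨U, hi, hj, hU⟩ := hV hβ
  refine ⟨U, hi, hj, ?_⟩
  have key : ∀ i ∈ U, ∀ j ∉ U, ∀ m n : Fin (M + 1), β i * (m : ℕ) = β j * (n : ℕ) →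
      β i * (m : ℕ) = 0 := by
    intro i hi j hj m n h
    by_contra h0
    have h0' := h0
    rw [h] at h0'
    rw [mul_eq_zero, not_or] at h0 h0'
    exact hU ⟨i, hi, j, hj, m, n, by omega, by omega, by exact_mod_cast h0.2,
      by exact_mod_cast h0'.2, h0.1, h0'.1, h⟩
  intro i j m n h
  by_cases hi : i ∈ U <;> by_cases hj : j ∈ U <;> simp only [hi, hj, Set.indicator_of_mem,
    Set.indicator_of_notMem, not_false_eq_true, zero_mul]
  · exact h
  · exact key i hi j hj m n h
  · exact (key j hj i hi n m h.symm).symm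

/-! ### Rates of deterministic policies -/

lemma sum_mul_le_maxRate_state {N K M : ℕ} (α : Fin N → ℝ) (s : ChannelState N K M)
    (I : Alloc N K) :
    ∑ n, α n * (service s I n : ℝ) ≤ ⨆ I : Alloc N K, ∑ n, α n * (service s I n : ℝ) :=
  le_ciSup (f := fun I : Alloc N K => ∑ n, α n * (service s I n : ℝ))
    (Set.finite_range _).bddAbove I

lemma sum_mul_policyRate {N K M : ℕ} (π : ChannelState N K M → ℝ)
    (g : ChannelState N K M → Alloc N K) (α : Fin N → ℝ) :
    ∑ n, α n * policyRate π g n = ∑ s, π s * ∑ n, α n * (service s (g s) n : ℝ) := by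
  simp only [policyRate, Finset.mul_sum]
  rw [Finset.sum_comm]
  exact Finset.sum_congr rfl fun _ _ => Finset.sum_congr rfl fun _ _ => by ring

lemma policyRate_nonneg {N K M : ℕ} {π : ChannelState N K M → ℝ} (hπ : ∀ s, 0 ≤ π s)
    (g : ChannelState N K M → Alloc N K) (n : Fin N) : 0 ≤ policyRate π g n :=
  Finset.sum_nonneg fun s _ => mul_nonneg (hπ s) (Nat.cast_nonneg _)

lemma sum_mul_policyRate_le {N K M : ℕ} {π : ChannelState N K M → ℝ} (hπ : ∀ s, 0 ≤ π s)
    (g : ChannelState N K M → Alloc N K) (α : Fin N → ℝ) :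
    ∑ n, α n * policyRate π g n ≤ maxRate π α := by
  rw [sum_mul_policyRate]
  exact Finset.sum_le_sum fun s _ =>
    mul_le_mul_of_nonneg_left (sum_mul_le_maxRate_state α s (g s)) (hπ s)

/-- A half-space, for the pairing by coordinate sums, is convex. -/
lemma convex_sum_mul_le {N : ℕ} (α : Fin N → ℝ) (b : ℝ) :
    Convex ℝ {x : Fin N → ℝ | ∑ n, α n * x n ≤ b} := by
  refine convex_halfSpace_le (f := fun x : Fin N → ℝ => ∑ n, α n * x n) ⟨?_, ?_⟩ b
  · intro x y; simp [mul_add, Finset.sum_add_distrib]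
  · intro c x; simp only [Pi.smul_apply, smul_eq_mul, Finset.mul_sum]
    exact Finset.sum_congr rfl fun _ _ => by ring

lemma sum_mul_le_maxRate {N K M : ℕ} {π : ChannelState N K M → ℝ} (hπ : ∀ s, 0 ≤ π s)
    (α : Fin N → ℝ) {x : Fin N → ℝ} (hx : x ∈ ratePolytope π) :
    ∑ n, α n * x n ≤ maxRate π α := by
  refine convexHull_min ?_ (convex_sum_mul_le α (maxRate π α)) hx
  rintro _ ⟨g, rfl⟩
  exact sum_mul_policyRate_le hπ g α

lemma nonneg_of_mem_ratePolytope {N K M : ℕ} {π : ChannelState N K M → ℝ} (hπ : ∀ s, 0 ≤ π s)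
    {x : Fin N → ℝ} (hx : x ∈ ratePolytope π) (n : Fin N) : 0 ≤ x n := by
  have : ratePolytope π ⊆ {x : Fin N → ℝ | ∀ n, 0 ≤ x n} := by
    refine convexHull_min ?_ ?_
    · rintro _ ⟨g, rfl⟩
      exact policyRate_nonneg hπ g
    · exact convex_Ici (0 : Fin N → ℝ)
  exact this hx n

lemma policyRate_mem {N K M : ℕ} (π : ChannelState N K M → ℝ)
    (g : ChannelState N K M → Alloc N K) : policyRate π g ∈ ratePolytope π :=
  subset_convexHull ℝ _ ⟨g, rfl⟩

/-- The allocation that gives server `k` to the queue `f k`. -/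
def allocOf {N K : ℕ} (f : Fin K → Fin N) : Alloc N K :=
  ⟨fun n k => if n = f k then 1 else 0, fun k => by
    have : ∀ n : Fin N, (((if n = f k then 1 else 0 : Fin 2)) : ℕ) = if n = f k then 1 else 0 := by
      intro n; split_ifs <;> rfl
    simp [this]⟩

lemma sum_mul_service_allocOf {N K M : ℕ} (α : Fin N → ℝ) (s : ChannelState N K M)
    (f : Fin K → Fin N) :
    ∑ n, α n * (service s (allocOf f) n : ℝ) = ∑ k, α (f k) * (s (f k) k : ℕ) := by
  have : ∀ n k, (((allocOf f).1 n k : ℕ) : ℝ) = if n = f k then 1 else 0 := by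
    intro n k; simp only [allocOf]; split_ifs <;> simp
  simp only [service, Nat.cast_sum, Nat.cast_mul, this, Finset.mul_sum]
  rw [Finset.sum_comm]
  simp

/-- Weighting each queue by `β`, giving every server to a queue where `β_n c_{nk}` is largest is
optimal. -/
lemma sum_mul_service_le {N K M : ℕ} {β : Fin N → ℝ} {s : ChannelState N K M}
    {f : Fin K → Fin N} (h0 : ∀ n, 0 ≤ β n)
    (hf : ∀ k n, β n * (s n k : ℕ) ≤ β (f k) * (s (f k) k : ℕ)) (I : Alloc N K) :
    ∑ n, β n * (service s I n : ℝ) ≤ ∑ n, β n * (service s (allocOf f) n : ℝ) := by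
  rw [sum_mul_service_allocOf]
  simp only [service, Nat.cast_sum, Nat.cast_mul, Finset.mul_sum]
  rw [Finset.sum_comm]
  refine Finset.sum_le_sum fun k _ => ?_
  have hI : ∑ n, ((I.1 n k : ℕ) : ℝ) ≤ 1 := by exact_mod_cast I.2 k
  calc ∑ n, β n * (((s n k : ℕ) : ℝ) * ((I.1 n k : ℕ) : ℝ))
      ≤ ∑ n, β (f k) * (s (f k) k : ℕ) * ((I.1 n k : ℕ) : ℝ) := by
        refine Finset.sum_le_sum fun n _ => ?_
        rw [← mul_assoc]
        exact mul_le_mul_of_nonneg_right (hf k n) (Nat.cast_nonneg _)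
    _ = β (f k) * (s (f k) k : ℕ) * ∑ n, ((I.1 n k : ℕ) : ℝ) := by rw [Finset.mul_sum]
    _ ≤ β (f k) * (s (f k) k : ℕ) :=
        mul_le_of_le_one_right (mul_nonneg (h0 _) (Nat.cast_nonneg _)) hI

/-- The maximal rate is linear on a cell: one policy is optimal for all weights in the cell,
because the best queue of each server is determined by the comparisons that define the cell. -/
lemma exists_policy_maxRate_eq {N K M : ℕ} (hN : 1 ≤ N) (hM : 1 ≤ M)
    (π : ChannelState N K M → ℝ) {α : Fin N → ℝ} (hα : ∀ n, 0 ≤ α n) :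
    ∃ g : ChannelState N K M → Alloc N K, ∀ β ∈ cell M α,
      maxRate π β = ∑ n, β n * policyRate π g n := by
  have : Nonempty (Fin N) := ⟨⟨0, hN⟩⟩
  have hmax : ∀ (s : ChannelState N K M) (k : Fin K), ∃ i, ∀ n,
      α n * (s n k : ℕ) ≤ α i * (s i k : ℕ) := fun s k =>
    Finite.exists_max fun n => α n * ((s n k : ℕ) : ℝ)
  choose f hf using hmax
  refine ⟨fun s => allocOf (f s), fun β hβ => ?_⟩
  rw [sum_mul_policyRate]
  refine Finset.sum_congr rfl fun s _ => ?_
  congr 1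
  have : Nonempty (Alloc N K) := ⟨allocOf (f s)⟩
  refine le_antisymm (ciSup_le fun I => ?_) (sum_mul_le_maxRate_state β s _)
  exact sum_mul_service_le (nonneg_of_mem_cell hM hα hβ)
    (fun k n => hβ n (f s k) _ _ (hf s k n)) I

lemma maxRate_nonneg {N K M : ℕ} {π : ChannelState N K M → ℝ} (hπ : ∀ s, 0 ≤ π s)
    (hN : 1 ≤ N) {α : Fin N → ℝ} (hα : ∀ n, 0 ≤ α n) : 0 ≤ maxRate π α :=
  le_trans (Finset.sum_nonneg fun n _ => mul_nonneg (hα n) (policyRate_nonneg hπ _ n))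
    (sum_mul_policyRate_le hπ (fun _ => allocOf fun _ => ⟨0, hN⟩) α)

/-! ### Representatives of `V` -/

lemma finite_W (N M : ℕ) : (W N M).Finite := by
  have : W N M ⊆ Set.range fun m : Fin (N - 1) → Fin (M + 1) => ∏ j, (m j : ℕ) := by
    rintro _ ⟨m, hm, rfl⟩
    exact ⟨fun j => ⟨m j, by have := hm j; omega⟩, rfl⟩
  exact (Set.finite_range _).subset this

lemma finite_of_subset_W {N M : ℕ} {Vhat : Set (Fin N → ℝ)}
    (h : ∀ β ∈ Vhat, ∀ n, ∃ z ∈ W N M, β n = (z : ℝ)) : Vhat.Finite := by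
  refine (Set.Finite.pi' (t := fun _ : Fin N => (Nat.cast '' W N M : Set ℝ))
    fun _ => (finite_W N M).image _).subset fun β hβ n => ?_
  obtain ⟨z, hz, h⟩ := h β hβ n
  exact ⟨z, hz, h.symm⟩

/-- `z` is a product of `k` nonzero elements of `{0, …, M}`. -/
def IsPosProd (M k : ℕ) (z : ℝ) : Prop :=
  ∃ m : Fin k → ℕ, (∀ j, m j ≤ M ∧ m j ≠ 0) ∧ z = ∏ j, (m j : ℝ)

lemma IsPosProd.mul {M k : ℕ} {z : ℝ} (h : IsPosProd M k z) {m : ℕ} (hm : m ≤ M) (h0 : m ≠ 0) :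
    IsPosProd M (k + 1) (z * m) := by
  obtain ⟨l, hl, rfl⟩ := h
  refine ⟨Fin.snoc l m, fun j => ?_, ?_⟩
  · induction j using Fin.lastCases <;> simp [hm, h0, hl]
  · simp [Fin.prod_univ_castSucc]

lemma IsPosProd.mono {M k l : ℕ} {z : ℝ} (hM : 1 ≤ M) (h : IsPosProd M k z) (hkl : k ≤ l) :
    IsPosProd M l z := by
  induction l, hkl using Nat.le_induction with
  | base => exact h
  | succ l _ ih => simpa using ih.mul hM one_ne_zero

lemma IsPosProd.exists_mem_W {N M : ℕ} {z : ℝ} (h : IsPosProd M (N - 1) z) :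
    ∃ w ∈ W N M, z = (w : ℝ) := by
  obtain ⟨m, hm, rfl⟩ := h
  exact ⟨_, ⟨m, fun j => (hm j).1, rfl⟩, by simp⟩

/-- For `α ∈ V` the graph of ties on the support is connected; joining the support one tie at a
time, `k` ties turn the entries on `k + 1` indices into products of `k` factors, after a common
scaling. -/
lemma exists_scaled_products {N M : ℕ} {α : Fin N → ℝ} (hα : α ∈ V N M) {k : ℕ}
    (hk : k + 1 ≤ (Finset.univ.filter fun i => α i ≠ 0).card) :
    ∃ S : Finset (Fin N), S.card = k + 1 ∧ (∀ i ∈ S, α i ≠ 0) ∧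
      ∃ q : ℝ, 0 < q ∧ ∀ i ∈ S, IsPosProd M k (q * α i) := by
  induction k with
  | zero =>
    obtain ⟨i, hi⟩ := Finset.card_pos.mp (by omega : 0 < (Finset.univ.filter fun i => α i ≠ 0).card)
    have hi : α i ≠ 0 := by simpa using hi
    refine ⟨{i}, by simp, by simpa using hi, (α i)⁻¹,
      inv_pos.mpr (lt_of_le_of_ne (hα.1 i) hi.symm), fun j hj => ⟨Fin.elim0, fun j => j.elim0, ?_⟩⟩
    rw [Finset.mem_singleton.mp hj]
    simp [hi]
  | succ k ih =>
    obtain ⟨S, hS, hS0, q, hq, hprod⟩ := ih (by omega)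
    have hne : S.Nonempty := Finset.card_pos.mp (by omega)
    obtain ⟨i₀, hi₀⟩ := hne
    have hex : ∃ j, α j ≠ 0 ∧ j ∉ S := by
      by_contra! h
      have : (Finset.univ.filter fun i => α i ≠ 0) ⊆ S := fun j hj => h j (by simpa using hj)
      have := Finset.card_le_card this
      omega
    obtain ⟨j₀, hj₀, hj₀S⟩ := hex
    obtain ⟨i, hi, j, hj, m, n, hm, hn, hm0, hn0, hαi, hαj, hmn⟩ :=
      hα.2 (S : Set (Fin N)) ⟨i₀, hi₀, hS0 i₀ hi₀⟩ ⟨j₀, by simpa using hj₀S, hj₀⟩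
    have hj : j ∉ S := by simpa using hj
    refine ⟨insert j S, by rw [Finset.card_insert_of_notMem hj, hS], ?_, q * n,
      mul_pos hq (by positivity), ?_⟩
    · intro l hl
      rcases Finset.mem_insert.mp hl with rfl | hl
      exacts [hαj, hS0 l hl]
    · intro l hl
      rcases Finset.mem_insert.mp hl with rfl | hl
      · have := (hprod i hi).mul hm hm0
        rwa [show q * n * α l = q * α i * m by linear_combination -q * hmn]
      · rw [show q * n * α l = q * α l * n by ring]
        exact (hprod l hl).mul hn hn0

lemma smul_mem_V {N M : ℕ} {α : Fin N → ℝ} (hα : α ∈ V N M) {q : ℝ} (hq : 0 < q) :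
    q • α ∈ V N M := by
  have h0 : ∀ i, (q • α) i ≠ 0 ↔ α i ≠ 0 := by intro i; simp [hq.ne']
  refine ⟨fun n => mul_nonneg hq.le (hα.1 n), fun U hi hj => ?_⟩
  simp only [h0] at hi hj ⊢
  obtain ⟨i, hi, j, hj, m, n, hm, hn, hm0, hn0, hαi, hαj, hmn⟩ := hα.2 U hi hj
  refine ⟨i, hi, j, hj, m, n, hm, hn, hm0, hn0, hαi, hαj, ?_⟩
  simp only [Pi.smul_apply, smul_eq_mul]
  linear_combination q * hmn

/-- Every nonzero vector of `V` is a positive multiple of a vector with entries in `W`. -/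
lemma exists_smul_mem_W {N M : ℕ} (hM : 1 ≤ M) {α : Fin N → ℝ} (hα : α ∈ V N M)
    (h0 : α ≠ 0) : ∃ q : ℝ, 0 < q ∧ ∀ n, ∃ w ∈ W N M, (q • α) n = (w : ℝ) := by
  set T := Finset.univ.filter fun i => α i ≠ 0 with hT
  have hpos : 0 < T.card := by
    obtain ⟨i, hi⟩ := Function.ne_iff.mp h0
    exact Finset.card_pos.mpr ⟨i, by simpa [hT] using hi⟩
  have hle : T.card ≤ N := by simpa using Finset.card_le_univ T
  obtain ⟨S, hS, hS0, q, hq, hprod⟩ := exists_scaled_products hα (k := T.card - 1)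
    (by rw [← hT]; omega)
  have hST : S = T := Finset.eq_of_subset_of_card_le (fun i hi => by simpa [hT] using hS0 i hi)
    (by omega)
  refine ⟨q, hq, fun n => ?_⟩
  by_cases hn : α n = 0
  · -- a zero entry is an empty product only if `N = 1`, but then `α = 0`
    have hlt : T.card < N := by
      have : T ⊂ Finset.univ := Finset.ssubset_univ_iff.mpr fun h => by
        have : n ∈ T := h ▸ Finset.mem_univ n
        simp [hT, hn] at this
      simpa using Finset.card_lt_card this
    refine ⟨0, ⟨fun _ => 0, fun _ => Nat.zero_le _, ?_⟩, by simp [hn]⟩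
    rw [Finset.prod_const, Finset.card_univ, Fintype.card_fin, zero_pow (by omega)]
  · have hnS : n ∈ S := hST ▸ (by simpa [hT] using hn)
    exact ((hprod n hnS).mono hM (by omega)).exists_mem_W

lemma exists_generatesV {N M : ℕ} (hM : 1 ≤ M) :
    ∃ Vhat : Set (Fin N → ℝ), Vhat ⊆ V N M \ {0} ∧ GeneratesV M Vhat := by
  refine ⟨{β | β ∈ V N M \ {0} ∧ ∀ n, ∃ w ∈ W N M, β n = (w : ℝ)}, fun β hβ => hβ.1,
    ⟨fun β hβ => hβ.2, fun α hα h0 => ?_⟩⟩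
  obtain ⟨q, hq, hW⟩ := exists_smul_mem_W hM hα h0
  refine ⟨q⁻¹, inv_pos.mpr hq, q • α, ⟨⟨smul_mem_V hα hq, ?_⟩, hW⟩, ?_⟩
  · simpa [hq.ne'] using h0
  · rw [smul_smul, inv_mul_cancel₀ hq.ne', one_smul]

lemma GeneratesV.nonneg {N M : ℕ} {Vhat : Set (Fin N → ℝ)} (h : GeneratesV M Vhat)
    {β : Fin N → ℝ} (hβ : β ∈ Vhat) (n : Fin N) : 0 ≤ β n := by
  obtain ⟨z, _, hz⟩ := h.subset_W β hβ n
  rw [hz]; exact Nat.cast_nonneg z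

/-! ### The inequalities for `V` imply all inequalities with nonnegative coefficients -/

/-- The vectors in the cell of `α` that have the same coordinate sum as `α`. -/
def slice {N : ℕ} (M : ℕ) (α : Fin N → ℝ) : Set (Fin N → ℝ) :=
  {β | β ∈ cell M α ∧ ∑ n, β n = ∑ n, α n}

lemma convex_slice {N : ℕ} (M : ℕ) (α : Fin N → ℝ) : Convex ℝ (slice M α) := by
  intro β hβ γ hγ a b ha hb hab
  refine ⟨convex_cell M α hβ.1 hγ.1 ha hb hab, ?_⟩
  simp only [Pi.add_apply, Pi.smul_apply, smul_eq_mul, Finset.sum_add_distrib, ← Finset.mul_sum,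
    hβ.2, hγ.2]
  rw [← add_mul, hab, one_mul]

lemma isCompact_slice {N M : ℕ} (hM : 1 ≤ M) {α : Fin N → ℝ} (hα : ∀ n, 0 ≤ α n) :
    IsCompact (slice M α) := by
  refine (isCompact_Icc (a := (0 : Fin N → ℝ)) (b := fun _ => ∑ n, α n)).of_isClosed_subset
    ((isClosed_cell M α).inter (isClosed_eq (by fun_prop) (by fun_prop))) ?_
  intro β hβ
  have h0 := nonneg_of_mem_cell hM hα hβ.1
  refine ⟨h0, fun n => ?_⟩
  rw [← hβ.2]
  exact Finset.single_le_sum (fun i _ => h0 i) (Finset.mem_univ n)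

/-- An extreme point `β` of a slice lies in `V`: otherwise the part `β_U` of a tie-free splitting
could be rescaled slightly, up and down, within the cell. -/
lemma extremePoints_slice_subset {N M : ℕ} (hM : 1 ≤ M) {α : Fin N → ℝ} (hα : ∀ n, 0 ≤ α n)
    {β : Fin N → ℝ} (hβ : β ∈ (slice M α).extremePoints ℝ) : β ∈ V N M := by
  by_contra hV
  obtain ⟨hmem, hext⟩ := mem_extremePoints_iff_left.mp hβ
  have h0 := nonneg_of_mem_cell hM hα hmem.1
  obtain ⟨U, ⟨i, hi, hi0⟩, ⟨j, hj, hj0⟩, htie⟩ := exists_indicator_of_notMem_V h0 hV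
  set s := ∑ n, β n with hs
  set u := ∑ n, U.indicator β n with hu
  have hUi : U.indicator β i = β i := Set.indicator_of_mem hi β
  have hupos : 0 < u := lt_of_lt_of_le (hUi ▸ lt_of_le_of_ne (h0 i) hi0.symm)
    (Finset.single_le_sum (fun n _ => Set.indicator_nonneg (fun n _ => h0 n) n)
      (Finset.mem_univ i))
  have hspos : 0 < s := lt_of_lt_of_le (lt_of_le_of_ne (h0 i) hi0.symm)
    (Finset.single_le_sum (fun n _ => h0 n) (Finset.mem_univ i))
  -- correcting `β_U` by a multiple of `β` makes the coordinate sum vanish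
  set d : Fin N → ℝ := fun n => U.indicator β n - u / s * β n with hd
  have hdsum : ∑ n, d n = 0 := by
    simp only [hd, Finset.sum_sub_distrib, ← Finset.mul_sum]
    rw [← hs, ← hu, div_mul_cancel₀ _ hspos.ne', sub_self]
  obtain ⟨ε, hε, h1, h2⟩ := exists_pos_add_sub_mem_cell (M := M) (β := β) (d := d) (by
    intro k l m n h
    have := htie k l m n h
    simp only [hd]
    linear_combination this - u / s * h)
  have m1 : β + ε • d ∈ slice M α := by
    refine ⟨cell_trans hmem.1 h1, ?_⟩
    simp only [Pi.add_apply, Pi.smul_apply, smul_eq_mul, Finset.sum_add_distrib,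
      ← Finset.mul_sum, hdsum, mul_zero, add_zero, ← hmem.2]
  have m2 : β - ε • d ∈ slice M α := by
    refine ⟨cell_trans hmem.1 h2, ?_⟩
    simp only [Pi.sub_apply, Pi.smul_apply, smul_eq_mul, Finset.sum_sub_distrib,
      ← Finset.mul_sum, hdsum, mul_zero, sub_zero, ← hmem.2]
  have heq := congrFun (hext _ m1 _ m2 ⟨1 / 2, 1 / 2, by norm_num, by norm_num, by norm_num, by
    ext n; simp only [Pi.add_apply, Pi.sub_apply, Pi.smul_apply, smul_eq_mul]; ring⟩) j
  simp only [hd, Pi.add_apply, Pi.smul_apply, smul_eq_mul, Set.indicator_of_notMem hj] at heq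
  have hne : ε * (u / s * β j) ≠ 0 :=
    mul_ne_zero hε.ne' (mul_ne_zero (div_pos hupos hspos).ne' hj0)
  exact hne (by linarith)

lemma finite_extremePoints_slice {N M : ℕ} (hM : 1 ≤ M) {α : Fin N → ℝ} (hα : ∀ n, 0 ≤ α n)
    (hpos : 0 < ∑ n, α n) : ((slice M α).extremePoints ℝ).Finite := by
  obtain ⟨Vhat, _, hgen⟩ := exists_generatesV (N := N) hM
  refine ((finite_of_subset_W hgen.subset_W).image
    fun v => ((∑ n, α n) / ∑ n, v n) • v).subset fun β hβ => ?_
  have hsum : ∑ n, β n = ∑ n, α n := (extremePoints_subset hβ).2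
  obtain ⟨q, hq, v, hv, rfl⟩ := hgen.cover β (extremePoints_slice_subset hM hα hβ) (by
    rintro rfl; simp at hsum; linarith)
  refine ⟨v, hv, ?_⟩
  simp only [Pi.smul_apply, smul_eq_mul, ← Finset.mul_sum] at hsum
  have : ∑ n, v n ≠ 0 := fun h => by rw [h] at hsum; linarith
  simp only [← hsum]
  rw [mul_div_cancel_right₀ _ this]

lemma mem_convexHull_extremePoints_slice {N M : ℕ} (hM : 1 ≤ M) {α : Fin N → ℝ}
    (hα : ∀ n, 0 ≤ α n) (hpos : 0 < ∑ n, α n) :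
    α ∈ convexHull ℝ ((slice M α).extremePoints ℝ) := by
  have h := closure_convexHull_extremePoints (isCompact_slice hM hα) (convex_slice M α)
  rw [(finite_extremePoints_slice hM hα hpos).isClosed_convexHull (𝕜 := ℝ) |>.closure_eq] at h
  rw [h]
  exact ⟨self_mem_cell α, rfl⟩

/-- Each `α ≥ 0` is a convex combination of vectors of `V` in its own cell, where the maximal
rate is linear. -/
lemma sum_mul_le_maxRate_of_generatesV {N K M : ℕ} (hN : 1 ≤ N) (hM : 1 ≤ M)
    (π : ChannelState N K M → ℝ) {Vhat : Set (Fin N → ℝ)} (hgen : GeneratesV M Vhat)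
    {x : Fin N → ℝ} (hx : ∀ v ∈ Vhat, ∑ n, v n * x n ≤ maxRate π v)
    {α : Fin N → ℝ} (hα : ∀ n, 0 ≤ α n) : ∑ n, α n * x n ≤ maxRate π α := by
  obtain ⟨g, hg⟩ := exists_policy_maxRate_eq hN hM π hα
  rw [hg α (self_mem_cell α)]
  rcases (Finset.sum_nonneg fun n _ => hα n : 0 ≤ ∑ n, α n).eq_or_lt with h0 | hpos
  · have : ∀ n, α n = 0 := fun n =>
      (Finset.sum_eq_zero_iff_of_nonneg fun n _ => hα n).mp h0.symm n (Finset.mem_univ n)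
    simp [this]
  have hsub : convexHull ℝ ((slice M α).extremePoints ℝ) ⊆
      {β : Fin N → ℝ | ∑ n, (x n - policyRate π g n) * β n ≤ 0} := by
    refine convexHull_min (fun β hβ => ?_) (convex_sum_mul_le _ _)
    have hmem := extremePoints_subset hβ
    obtain ⟨q, hq, v, hv, rfl⟩ := hgen.cover β (extremePoints_slice_subset hM hα hβ) (by
      rintro rfl; have := hmem.2; simp at this; linarith)
    have hvc : v ∈ cell M α := by
      simpa [smul_smul, hq.ne'] using smul_mem_cell (inv_pos.mpr hq).le hmem.1
    have hle := hx v hv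
    rw [hg v hvc, ← sub_nonpos, ← Finset.sum_sub_distrib] at hle
    have : ∑ n, (x n - policyRate π g n) * (q • v) n =
        q * ∑ n, (v n * x n - v n * policyRate π g n) := by
      rw [Finset.mul_sum]
      exact Finset.sum_congr rfl fun _ _ => by simp only [Pi.smul_apply, smul_eq_mul]; ring
    show ∑ n, (x n - policyRate π g n) * (q • v) n ≤ 0
    rw [this]
    exact mul_nonpos_of_nonneg_of_nonpos hq.le hle
  have := hsub (mem_convexHull_extremePoints_slice hM hα hpos)
  have h : ∑ n, (x n - policyRate π g n) * α n ≤ 0 := this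
  rw [← sub_nonpos, ← Finset.sum_sub_distrib]
  convert h using 2
  ring_nf

/-! ### The polytope as an intersection of half-spaces -/

/-- No server is given to the queues in `Z`, all other assignments are those of `I`. -/
def idle {N K : ℕ} (Z : Finset (Fin N)) (I : Alloc N K) : Alloc N K :=
  ⟨fun n k => if n ∈ Z then 0 else I.1 n k, fun k =>
    (Finset.sum_le_sum fun n _ => by dsimp only; split_ifs <;> simp).trans (I.2 k)⟩

lemma policyRate_idle {N K M : ℕ} (π : ChannelState N K M → ℝ) (Z : Finset (Fin N))
    (g : ChannelState N K M → Alloc N K) (n : Fin N) :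
    policyRate π (fun s => idle Z (g s)) n = if n ∈ Z then 0 else policyRate π g n := by
  split_ifs with h <;> simp [policyRate, service, idle, h]

/-- A point outside the polytope is separated from it by some `a`; the positive part of `a` still
separates, since a policy may leave the queues with `a_n < 0` unserved. -/
lemma mem_ratePolytope_of_le_maxRate {N K M : ℕ} (hN : 1 ≤ N) (hM : 1 ≤ M)
    (π : ChannelState N K M → ℝ) {x : Fin N → ℝ} (h0 : ∀ n, 0 ≤ x n)
    (hx : ∀ α : Fin N → ℝ, (∀ n, 0 ≤ α n) → ∑ n, α n * x n ≤ maxRate π α) :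
    x ∈ ratePolytope π := by
  by_contra hnot
  obtain ⟨f, u, hf, hfx⟩ := geometric_hahn_banach_closed_point (convex_convexHull ℝ _)
    ((Set.finite_range (policyRate π)).isClosed_convexHull (𝕜 := ℝ)) hnot
  set a : Fin N → ℝ := fun n => f (Pi.single n 1) with ha
  have hfa : ∀ y : Fin N → ℝ, f y = ∑ n, a n * y n := by
    intro y
    conv_lhs => rw [pi_eq_sum_univ' y]
    simp only [map_sum, map_smul, smul_eq_mul, ha]
    exact Finset.sum_congr rfl fun n _ => mul_comm _ _
  set α : Fin N → ℝ := fun n => max (a n) 0 with hα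
  have hα0 : ∀ n, 0 ≤ α n := fun n => le_max_right _ _
  obtain ⟨g, hg⟩ := exists_policy_maxRate_eq hN hM π hα0
  have h1 : ∑ n, α n * policyRate π g n < u := by
    have := hf _ (policyRate_mem π fun s => idle (Finset.univ.filter fun n => a n < 0) (g s))
    rw [hfa] at this
    refine lt_of_eq_of_lt (Finset.sum_congr rfl fun n _ => ?_) this
    rw [policyRate_idle]
    by_cases h : a n < 0
    · simp [h, hα, max_eq_right h.le]
    · simp [h, hα, max_eq_left (not_lt.mp h)]
  have h2 : u < ∑ n, α n * x n := by
    rw [hfa] at hfx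
    exact hfx.trans_le (Finset.sum_le_sum fun n _ =>
      mul_le_mul_of_nonneg_right (le_max_left _ _) (h0 n))
  have := hx α hα0
  rw [hg α (self_mem_cell α)] at this
  linarith

lemma ratePolytope_eq {N K M : ℕ} (hN : 1 ≤ N) (hM : 1 ≤ M) {π : ChannelState N K M → ℝ}
    (hπ : ∀ s, 0 ≤ π s) {Vhat : Set (Fin N → ℝ)} (hgen : GeneratesV M Vhat) :
    ratePolytope π =
      {x | (∀ n, 0 ≤ x n) ∧ ∀ α ∈ Vhat, ∑ n, α n * x n ≤ maxRate π α} := by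
  ext x
  refine ⟨fun hx => ⟨nonneg_of_mem_ratePolytope hπ hx, fun α _ => sum_mul_le_maxRate hπ α hx⟩,
    fun hx => mem_ratePolytope_of_le_maxRate hN hM π hx.1 fun α hα =>
      sum_mul_le_maxRate_of_generatesV hN hM π hgen hx.2 hα⟩

/-! ### Facets -/

/-- The linear form `x ↦ a x`. -/
noncomputable def pairing {N : ℕ} (a : Fin N → ℝ) : (Fin N → ℝ) →ₗ[ℝ] ℝ :=
  ∑ n, a n • LinearMap.proj n

lemma pairing_apply {N : ℕ} (a x : Fin N → ℝ) : pairing a x = ∑ n, a n * x n := by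
  simp [pairing]

lemma pairing_self_pos {N : ℕ} {a : Fin N → ℝ} (ha : a ≠ 0) : 0 < pairing a a := by
  obtain ⟨i, hi⟩ := Function.ne_iff.mp ha
  rw [pairing_apply]
  exact Finset.sum_pos' (fun n _ => mul_self_nonneg _)
    ⟨i, Finset.mem_univ i, mul_self_pos.mpr hi⟩

/-- A set of dimension `N - 1` in the hyperplane `a x = b` spans the direction of that
hyperplane. -/
lemma vectorSpan_eq_ker {N : ℕ} {a : Fin N → ℝ} (ha : a ≠ 0) {b : ℝ} {F : Set (Fin N → ℝ)}
    (hF : ∀ x ∈ F, pairing a x = b) (hdim : dim F + 1 = N) :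
    vectorSpan ℝ F = LinearMap.ker (pairing a) := by
  have hle : vectorSpan ℝ F ≤ LinearMap.ker (pairing a) := by
    rw [vectorSpan_def, Submodule.span_le]
    rintro _ ⟨x, hx, y, hy, rfl⟩
    simp [hF x hx, hF y hy]
  refine Submodule.eq_of_le_of_finrank_eq hle ?_
  have hne : pairing a ≠ 0 := fun h => (pairing_self_pos ha).ne' (by rw [h]; rfl)
  have := Module.Dual.finrank_ker_add_one_of_ne_zero (f := pairing a) hne
  rw [Module.finrank_fin_fun] at this
  unfold dim at hdim
  omega

/-- In a convex set there is a point at which every constraint is strict, apart from those that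
are tight on the whole set. -/
lemma exists_forall_lt {N : ℕ} {ι : Type*} {c : ι → Fin N → ℝ} {d : ι → ℝ}
    {F : Set (Fin N → ℝ)} (hconv : Convex ℝ F) (hne : F.Nonempty)
    (hle : ∀ x ∈ F, ∀ i, pairing (c i) x ≤ d i) (s : Finset ι) :
    ∃ y ∈ F, ∀ i ∈ s, (∃ z ∈ F, pairing (c i) z < d i) → pairing (c i) y < d i := by
  classical
  induction s using Finset.induction_on with
  | empty => obtain ⟨y, hy⟩ := hne; exact ⟨y, hy, by simp⟩
  | insert i s _ ih =>
    obtain ⟨y, hy, hys⟩ := ih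
    by_cases h : ∃ z ∈ F, pairing (c i) z < d i
    · obtain ⟨z, hz, hzi⟩ := h
      refine ⟨(1 / 2 : ℝ) • y + (1 / 2 : ℝ) • z,
        hconv hy hz (by norm_num) (by norm_num) (by norm_num), fun j hj hex => ?_⟩
      simp only [map_add, map_smul, smul_eq_mul]
      rcases Finset.mem_insert.mp hj with rfl | hj
      · linarith [hle y hy j]
      · linarith [hys j hj hex, hle z hz j]
    · refine ⟨y, hy, fun j hj hex => ?_⟩
      rcases Finset.mem_insert.mp hj with rfl | hj
      exacts [absurd hex h, hys j hj hex]

/-- A facet of a full-dimensional polyhedron `{x | c_i x ≤ d_i for all i}`, with finitely many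
constraints, is the set where one of the constraints is tight. -/
lemma IsFacet.exists_tight {N : ℕ} {ι : Type*} [Finite ι] {c : ι → Fin N → ℝ} {d : ι → ℝ}
    {P F : Set (Fin N → ℝ)} (hP : P = {x | ∀ i, pairing (c i) x ≤ d i}) (hdim : dim P = N)
    (hF : IsFacet P F) : ∃ i, c i ≠ 0 ∧ F = {x | x ∈ P ∧ pairing (c i) x = d i} := by
  obtain ⟨⟨a, b, hab, hFeq⟩, hne, hFdim⟩ := hF
  simp only [← pairing_apply] at hab hFeq
  have hFP : F ⊆ P := fun x hx => by rw [hFeq] at hx; exact hx.1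
  have hFb : ∀ x ∈ F, pairing a x = b := fun x hx => by rw [hFeq] at hx; exact hx.2
  have ha : a ≠ 0 := by
    rintro rfl
    have hzero : ∀ x, pairing (0 : Fin N → ℝ) x = 0 := fun x => by simp [pairing_apply]
    obtain ⟨y, hy⟩ := hne
    have hb : b = 0 := by rw [← hFb y hy, hzero]
    have : F = P := by
      rw [hFeq]; ext x; simp [hzero, hb]
    rw [this] at hFdim
    omega
  have hconv : Convex ℝ F := by
    intro x hx y hy s t hs ht hst
    rw [hFeq]
    refine ⟨?_, ?_⟩
    · rw [hP]
      intro i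
      have h1 := hFP hx
      have h2 := hFP hy
      rw [hP] at h1 h2
      have h1 := mul_le_mul_of_nonneg_left (h1 i) hs
      have h2 := mul_le_mul_of_nonneg_left (h2 i) ht
      simp only [map_add, map_smul, smul_eq_mul]
      calc _ ≤ s * d i + t * d i := add_le_add h1 h2
        _ = d i := by rw [← add_mul, hst, one_mul]
    · simp only [map_add, map_smul, smul_eq_mul, hFb x hx, hFb y hy]
      rw [← add_mul, hst, one_mul]
  have hle : ∀ x ∈ F, ∀ i, pairing (c i) x ≤ d i := fun x hx => by
    have := hFP hx; rwa [hP] at this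
  have htight : ∃ i, c i ≠ 0 ∧ ∀ x ∈ F, pairing (c i) x = d i := by
    by_contra! hcon
    have := Fintype.ofFinite ι
    obtain ⟨y, hy, hys⟩ := exists_forall_lt hconv hne hle Finset.univ
    -- the point `y + ε a` still satisfies all constraints, but violates `a x ≤ b`
    have hev : ∀ᶠ ε in 𝓝 (0 : ℝ), ∀ i, pairing (c i) (y + ε • a) ≤ d i := by
      rw [eventually_all]
      intro i
      by_cases hci : c i = 0
      · refine Eventually.of_forall fun ε => ?_
        have := hle y hy i
        simpa [hci, pairing_apply] using this
      · obtain ⟨z, hz, hzi⟩ := hcon i hci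
        have hlt := hys i (Finset.mem_univ i) ⟨z, hz, lt_of_le_of_ne (hle z hz i) hzi⟩
        have hcont : Continuous fun ε : ℝ => pairing (c i) y + ε * pairing (c i) a := by fun_prop
        have ht : Tendsto (fun ε : ℝ => pairing (c i) y + ε * pairing (c i) a) (𝓝 0)
            (𝓝 (pairing (c i) y)) := by simpa using hcont.tendsto 0
        filter_upwards [ht.eventually_lt_const hlt] with ε hε
        simpa using hε.le
    have hpos : ∀ᶠ ε in 𝓝[>] (0 : ℝ), 0 < ε := eventually_mem_nhdsWithin
    obtain ⟨ε, hε, hmem⟩ := (hpos.and (hev.filter_mono nhdsWithin_le_nhds)).exists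
    have h1 := hab (y + ε • a) (by rw [hP]; exact hmem)
    simp only [map_add, map_smul, smul_eq_mul, hFb y hy] at h1
    have := mul_pos hε (pairing_self_pos ha)
    linarith
  obtain ⟨i, hci, hi⟩ := htight
  refine ⟨i, hci, Set.Subset.antisymm (fun x hx => ⟨hFP hx, hi x hx⟩) fun x hx => ?_⟩
  obtain ⟨y, hy⟩ := hne
  -- both `a` and `c i` cut out the affine span of `F`
  have hker := (vectorSpan_eq_ker ha hFb (by omega)).symm.trans
    (vectorSpan_eq_ker hci hi (by omega))
  have hxy : x - y ∈ LinearMap.ker (pairing a) := by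
    rw [hker, LinearMap.mem_ker, map_sub, hx.2, hi y hy, sub_self]
  rw [LinearMap.mem_ker, map_sub, sub_eq_zero, hFb y hy] at hxy
  rw [hFeq]
  exact ⟨hx.1, hxy⟩

/-- For `α ∉ V`, the maximal rate is also linear along the perturbations `α ± ε α_U`, so that the
face of `α` lies in the two independent hyperplanes given by `α` and `α_U`. -/
lemma not_isFacet_of_notMem_V {N K M : ℕ} (hN : 1 ≤ N) (hM : 1 ≤ M)
    {π : ChannelState N K M → ℝ} (hπ : ∀ s, 0 ≤ π s) (hdim : dim (ratePolytope π) = N)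
    {α : Fin N → ℝ} (hα : ∀ n, 0 ≤ α n) (hV : α ∉ V N M) :
    ¬ IsFacet (ratePolytope π)
      {x | x ∈ ratePolytope π ∧ ∑ n, α n * x n = maxRate π α} := by
  rintro ⟨-, -, hFdim⟩
  rw [hdim] at hFdim
  simp only [← pairing_apply] at hFdim
  obtain ⟨U, ⟨i, hi, hi0⟩, ⟨j, hj, hj0⟩, htie⟩ := exists_indicator_of_notMem_V hα hV
  obtain ⟨ε, hε, h1, h2⟩ := exists_pos_add_sub_mem_cell htie
  obtain ⟨g, hg⟩ := exists_policy_maxRate_eq hN hM π hα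
  simp only [← pairing_apply] at hg
  have hlin : ∀ (t : ℝ) (x : Fin N → ℝ),
      pairing (α + t • U.indicator α) x = pairing α x + t * pairing (U.indicator α) x := by
    intro t x
    simp only [pairing_apply, Finset.mul_sum, ← Finset.sum_add_distrib]
    exact Finset.sum_congr rfl fun n _ => by
      simp only [Pi.add_apply, Pi.smul_apply, smul_eq_mul]; ring
  have hU : ∀ x ∈ {x | x ∈ ratePolytope π ∧ pairing α x = maxRate π α},
      pairing (U.indicator α) x = pairing (U.indicator α) (policyRate π g) := by
    rintro x ⟨hx, hxα⟩
    rw [hg α (self_mem_cell α)] at hxα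
    rw [sub_eq_add_neg, ← neg_smul] at h2
    have e1 := sum_mul_le_maxRate hπ (α + ε • U.indicator α) hx
    have e2 := sum_mul_le_maxRate hπ (α + (-ε) • U.indicator α) hx
    rw [← pairing_apply, hg _ h1, hlin, hlin, hxα] at e1
    rw [← pairing_apply, hg _ h2, hlin, hlin, hxα] at e2
    refine le_antisymm ?_ ?_
    · exact le_of_mul_le_mul_left (by linarith) hε
    · exact le_of_mul_le_mul_left (by linarith) hε
  have hα0 : α ≠ 0 := fun h => hi0 (by simp [h])
  have hU0 : U.indicator α ≠ 0 := fun h => hi0 (by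
    have := congrFun h i; rwa [Set.indicator_of_mem hi] at this)
  have hker := (vectorSpan_eq_ker hα0 (fun x hx => hx.2) hFdim).symm.trans
    (vectorSpan_eq_ker hU0 hU hFdim)
  have hij : i ≠ j := fun h => hj (h ▸ hi)
  have hsingle : ∀ (a : Fin N → ℝ) (k : Fin N) (t : ℝ),
      pairing a (Pi.single k t) = a k * t := by
    intro a k t; simp [pairing_apply, Pi.single_apply]
  have hmem : Pi.single i (α j) - Pi.single j (α i) ∈ LinearMap.ker (pairing α) := by
    rw [LinearMap.mem_ker, map_sub, hsingle, hsingle]; ring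
  rw [hker, LinearMap.mem_ker, map_sub, hsingle, hsingle, Set.indicator_of_mem hi,
    Set.indicator_of_notMem hj, zero_mul, sub_zero] at hmem
  exact mul_ne_zero hi0 hj0 hmem

/-! ### Necessity of the inequalities for strong stability -/

lemma runAvg_nonneg {a : ℕ → ℝ} (ha : ∀ t, 0 ≤ a t) (t : ℕ) : 0 ≤ runAvg a t :=
  div_nonneg (Finset.sum_nonneg fun τ _ => ha τ) (Nat.cast_nonneg t)

/-- A deterministic drift estimate. As the backlog `x` drops by at most `h` per slot, a large
value at time `t` forces large values in the next `m` slots; if the averages of `x` are bounded,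
then `x t / t` is asymptotically at most `B / m`, for every `m`. -/
lemma limsup_runAvg_le {a x : ℕ → ℝ} {h B : ℝ} (ha : ∀ t, 0 ≤ a t) (hx : ∀ t, 0 ≤ x t)
    (hh : 0 ≤ h) (hstep : ∀ t, x t + a (t + 1) - h ≤ x (t + 1))
    (hB : ∀ᶠ t : ℕ in atTop, ∑ τ ∈ Finset.range t, x τ ≤ B * t) :
    limsup (runAvg a) atTop ≤ h := by
  have hsum : ∀ t, ∑ τ ∈ Finset.Icc 1 t, a τ ≤ x t + t * h := by
    intro t
    induction t with
    | zero => simpa using hx 0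
    | succ t ih =>
      rw [Finset.sum_Icc_succ_top (by omega)]
      push_cast
      linarith [hstep t]
  have hdrop : ∀ t j, x t - j * h ≤ x (t + j) := by
    intro t j
    induction j with
    | zero => simp
    | succ j ih =>
      have := hstep (t + j)
      rw [← add_assoc]
      push_cast
      linarith [ha (t + j + 1)]
  have hwin : ∀ m : ℕ, ∀ᶠ t : ℕ in atTop, m * x t ≤ B * (t + m) + m * (m * h) := by
    intro m
    filter_upwards [(tendsto_add_atTop_nat m).eventually hB] with t ht
    have h1 : ∑ j ∈ Finset.range m, (x t - m * h) ≤ ∑ j ∈ Finset.range m, x (t + j) := by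
      refine Finset.sum_le_sum fun j hj => le_trans ?_ (hdrop t j)
      have : (j : ℝ) ≤ m := by exact_mod_cast (Finset.mem_range.mp hj).le
      have := mul_le_mul_of_nonneg_right this hh
      linarith
    have h2 : 0 ≤ ∑ j ∈ Finset.range t, x j := Finset.sum_nonneg fun j _ => hx j
    rw [Finset.sum_range_add] at ht
    rw [Finset.sum_const, Finset.card_range, nsmul_eq_mul] at h1
    push_cast at ht
    linarith
  have hcob : IsCoboundedUnder (· ≤ ·) atTop (runAvg a) :=
    isCoboundedUnder_le_of_le atTop (x := 0) (runAvg_nonneg ha)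
  have hm : ∀ m : ℕ, 1 ≤ m → limsup (runAvg a) atTop ≤ h + B / m + 1 / m := by
    intro m hm
    refine limsup_le_of_le hcob ?_
    have hlarge := tendsto_natCast_atTop_atTop (R := ℝ) |>.eventually_ge_atTop
      (B * m + m * (m * h))
    filter_upwards [hwin m, hlarge, eventually_gt_atTop 0] with t ht hl ht0
    have hm' : (0 : ℝ) < m := by exact_mod_cast hm
    have ht' : (0 : ℝ) < t := by exact_mod_cast ht0
    rw [runAvg, div_le_iff₀ ht', ← mul_le_mul_iff_right₀ hm']
    have e : (m : ℝ) * ((h + B / m + 1 / m) * t) = m * (t * h) + B * t + t := by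
      field_simp
    rw [e]
    have := mul_le_mul_of_nonneg_left (hsum t) hm'.le
    linarith
  refine ge_of_tendsto ?_ (eventually_atTop.mpr ⟨1, hm⟩)
  have l1 := tendsto_const_div_atTop_nhds_zero_nat B
  have l2 := tendsto_const_div_atTop_nhds_zero_nat (1 : ℝ)
  simpa using (l1.const_add h).add l2

variable {N K M : ℕ} {Ω : Type*} [MeasurableSpace Ω] {μ : Measure Ω}
  {C : ℕ → Ω → ChannelState N K M} {A : ℕ → Ω → Fin N → ℕ} {X₀ : Ω → Fin N → ℕ}
  {π : ChannelState N K M → ℝ} {Amax : ℝ≥0} {I : ℕ → Ω → Alloc N K}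

lemma IsSystem.prob_nonneg (hsys : IsSystem μ C A X₀ π Amax) (s : ChannelState N K M) :
    0 ≤ π s := hsys.channel_law 1 le_rfl s ▸ measureReal_nonneg

lemma IsSystem.measurable_service (hsys : IsSystem μ C A X₀ π Amax)
    (hI : ∀ t, 1 ≤ t → Measurable (I t))
    {t : ℕ} (ht : 1 ≤ t) (n : Fin N) : Measurable fun ω => service (C t ω) (I t ω) n :=
  (Measurable.of_discrete (f := fun p : ChannelState N K M × Alloc N K => service p.1 p.2 n)).comp
    ((hsys.measurable_channel t ht).prodMk (hI t ht))

lemma IsSystem.measurable_queue (hsys : IsSystem μ C A X₀ π Amax)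
    (hI : ∀ t, 1 ≤ t → Measurable (I t)) (t : ℕ) (n : Fin N) :
    Measurable fun ω => queue C A X₀ I t ω n := by
  induction t with
  | zero => exact (measurable_pi_apply n).comp hsys.measurable_init
  | succ t ih =>
    exact (ih.sub (hsys.measurable_service hI (by omega) n)).add
      ((measurable_pi_apply n).comp (hsys.measurable_arrival (t + 1) (by omega)))

lemma integrable_natCast_of_lintegral_lt_top {f : Ω → ℕ} (hf : Measurable f)
    (h : ∫⁻ ω, (f ω : ℝ≥0∞) ∂μ < ⊤) : Integrable (fun ω => (f ω : ℝ)) μ := by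
  refine ⟨(measurable_from_top.comp hf).aestronglyMeasurable, ?_⟩
  simpa [HasFiniteIntegral, enorm_eq_nnnorm] using h

lemma IsSystem.integrable_arrival (hsys : IsSystem μ C A X₀ π Amax) {t : ℕ} (ht : 1 ≤ t)
    (n : Fin N) : Integrable (fun ω => (A t ω n : ℝ)) μ := by
  refine integrable_natCast_of_lintegral_lt_top
    ((measurable_pi_apply n).comp (hsys.measurable_arrival t ht)) ?_
  calc ∫⁻ ω, (A t ω n : ℝ≥0∞) ∂μ ≤ ∫⁻ ω, (A t ω n : ℝ≥0∞) ^ 2 ∂μ :=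
        lintegral_mono fun ω => by
          rw [← Nat.cast_pow]
          exact Nat.cast_le.mpr (Nat.le_self_pow two_ne_zero _)
    _ ≤ (Amax : ℝ≥0∞) ^ 2 := hsys.arrival_second_moment t ht n
    _ < ⊤ := ENNReal.pow_lt_top ENNReal.coe_lt_top

lemma IsSystem.integrable_queue (hsys : IsSystem μ C A X₀ π Amax)
    (hI : ∀ t, 1 ≤ t → Measurable (I t)) (t : ℕ) (n : Fin N) :
    Integrable (fun ω => (queue C A X₀ I t ω n : ℝ)) μ := by
  induction t with
  | zero =>
    exact integrable_natCast_of_lintegral_lt_top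
      ((measurable_pi_apply n).comp hsys.measurable_init) (hsys.init_mean n)
  | succ t ih =>
    refine (ih.add (hsys.integrable_arrival (t := t + 1) (by omega) n)).mono'
      (measurable_from_top.comp (hsys.measurable_queue hI (t + 1) n)).aestronglyMeasurable
      (Eventually.of_forall fun ω => ?_)
    simp only [Real.norm_natCast, Pi.add_apply]
    rw [queue]
    exact_mod_cast Nat.add_le_add_right (Nat.sub_le _ _) _

lemma IsSystem.integrable_service [IsFiniteMeasure μ] (hsys : IsSystem μ C A X₀ π Amax)
    (hI : ∀ t, 1 ≤ t → Measurable (I t)) {t : ℕ} (ht : 1 ≤ t) (n : Fin N) :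
    Integrable (fun ω => (service (C t ω) (I t ω) n : ℝ)) μ := by
  obtain ⟨b, hb⟩ := (Set.finite_range
    fun p : ChannelState N K M × Alloc N K => (service p.1 p.2 n : ℝ)).bddAbove
  refine (integrable_const b).mono'
    (measurable_from_top.comp (hsys.measurable_service hI ht n)).aestronglyMeasurable
    (Eventually.of_forall fun ω => ?_)
  simpa using hb ⟨(C t ω, I t ω), rfl⟩

/-- Whatever the policy does, its weighted mean service in a slot is at most the maximal rate. -/
lemma IsSystem.integral_service_le [IsFiniteMeasure μ] (hsys : IsSystem μ C A X₀ π Amax)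
    (hI : ∀ t, 1 ≤ t → Measurable (I t)) {t : ℕ} (ht : 1 ≤ t) (α : Fin N → ℝ) :
    ∫ ω, ∑ n, α n * (service (C t ω) (I t ω) n : ℝ) ∂μ ≤ maxRate π α := by
  have hset : ∀ s, MeasurableSet {ω | C t ω = s} := fun s =>
    hsys.measurable_channel t ht (measurableSet_singleton s)
  set w : ChannelState N K M → ℝ :=
    fun s => ⨆ I : Alloc N K, ∑ n, α n * (service s I n : ℝ) with hw
  have hint : ∀ s ∈ Finset.univ,
      Integrable (fun ω => {ω | C t ω = s}.indicator (fun _ => w s) ω) μ :=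
    fun s _ => (integrable_const (w s)).indicator (hset s)
  calc ∫ ω, ∑ n, α n * (service (C t ω) (I t ω) n : ℝ) ∂μ
      ≤ ∫ ω, ∑ s, {ω | C t ω = s}.indicator (fun _ => w s) ω ∂μ := by
        refine integral_mono
          (integrable_finsetSum _ fun n _ => (hsys.integrable_service hI ht n).const_mul _)
          (integrable_finsetSum _ hint) fun ω => ?_
        have : ∑ s, {ω | C t ω = s}.indicator (fun _ => w s) ω = w (C t ω) := by
          simp [Set.indicator_apply]
        rw [this]
        exact sum_mul_le_maxRate_state α (C t ω) (I t ω)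
    _ = maxRate π α := by
        rw [integral_finsetSum _ hint, maxRate]
        refine Finset.sum_congr rfl fun s _ => ?_
        rw [integral_indicator_const _ (hset s), hsys.channel_law t ht s, smul_eq_mul]

/-- The expected weighted backlog `E[α X(t)]`. -/
noncomputable def meanBacklog (μ : Measure Ω) (X : ℕ → Ω → Fin N → ℕ) (α : Fin N → ℝ)
    (t : ℕ) : ℝ :=
  ∑ n, α n * ∫ ω, (X t ω n : ℝ) ∂μ

lemma IsSystem.meanBacklog_step [IsFiniteMeasure μ] (hsys : IsSystem μ C A X₀ π Amax)
    (hI : ∀ t, 1 ≤ t → Measurable (I t)) {α : Fin N → ℝ} (hα : ∀ n, 0 ≤ α n) (t : ℕ) :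
    meanBacklog μ (queue C A X₀ I) α t + ∑ n, α n * meanArrival μ A (t + 1) n - maxRate π α
      ≤ meanBacklog μ (queue C A X₀ I) α (t + 1) := by
  have hserv : ∑ n, α n * ∫ ω, (service (C (t + 1) ω) (I (t + 1) ω) n : ℝ) ∂μ ≤ maxRate π α := by
    refine le_of_eq_of_le ?_ (hsys.integral_service_le hI (t := t + 1) (by omega) α)
    rw [integral_finsetSum _ fun n _ => (hsys.integrable_service hI (by omega) n).const_mul _]
    exact Finset.sum_congr rfl fun n _ => (integral_const_mul _ _).symm
  have hn : ∀ n, ∫ ω, (queue C A X₀ I t ω n : ℝ) ∂μ + meanArrival μ A (t + 1) n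
      - ∫ ω, (service (C (t + 1) ω) (I (t + 1) ω) n : ℝ) ∂μ
      ≤ ∫ ω, (queue C A X₀ I (t + 1) ω n : ℝ) ∂μ := by
    intro n
    have i1 := hsys.integrable_queue hI t n
    have i2 := hsys.integrable_arrival (t := t + 1) (by omega) n
    have i3 := hsys.integrable_service hI (t := t + 1) (by omega) n
    have i12 : Integrable
        (fun ω => (queue C A X₀ I t ω n : ℝ) + (A (t + 1) ω n : ℝ)) μ := i1.add i2
    rw [meanArrival, ← integral_add i1 i2, ← integral_sub i12 i3]
    refine integral_mono (i12.sub i3) (hsys.integrable_queue hI (t + 1) n) fun ω => ?_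
    simp only
    rw [queue, Nat.cast_add]
    have : (queue C A X₀ I t ω n : ℝ) - service (C (t + 1) ω) (I (t + 1) ω) n ≤
        ((queue C A X₀ I t ω n - service (C (t + 1) ω) (I (t + 1) ω) n : ℕ) : ℝ) := by
      rw [sub_le_iff_le_add]
      exact_mod_cast le_tsub_add
    linarith
  have hsum := Finset.sum_le_sum fun n (_ : n ∈ Finset.univ) =>
    mul_le_mul_of_nonneg_left (hn n) (hα n)
  simp only [mul_sub, mul_add, Finset.sum_sub_distrib, Finset.sum_add_distrib] at hsum
  unfold meanBacklog
  linarith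

lemma IsSystem.exists_bound_meanBacklog (hsys : IsSystem μ C A X₀ π Amax)
    (hI : ∀ t, 1 ≤ t → Measurable (I t)) (hst : StronglyStable μ (queue C A X₀ I))
    {α : Fin N → ℝ} (hα : ∀ n, 0 ≤ α n) :
    ∃ B : ℝ, ∀ᶠ t : ℕ in atTop,
      ∑ τ ∈ Finset.range t, meanBacklog μ (queue C A X₀ I) α τ ≤ B * t := by
  have hn : ∀ n, ∃ b : ℝ≥0, ∀ᶠ t : ℕ in atTop,
      ∑ τ ∈ Finset.range t, ∫ ω, (queue C A X₀ I τ ω n : ℝ) ∂μ ≤ b * t := by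
    intro n
    obtain ⟨b, hb1, hb2⟩ := ENNReal.lt_iff_exists_nnreal_btwn.mp (hst n)
    refine ⟨b, ?_⟩
    filter_upwards [eventually_lt_of_limsup_lt hb1, eventually_gt_atTop 0] with t ht ht0
    have ht' := (ENNReal.div_le_iff (by exact_mod_cast ht0.ne') (ENNReal.natCast_ne_top t)).mp ht.le
    have hlin : ∀ τ, ∫⁻ ω, (queue C A X₀ I τ ω n : ℝ≥0∞) ∂μ =
        ENNReal.ofReal (∫ ω, (queue C A X₀ I τ ω n : ℝ) ∂μ) := by
      intro τ
      rw [ofReal_integral_eq_lintegral_ofReal (hsys.integrable_queue hI τ n)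
        (Eventually.of_forall fun ω => Nat.cast_nonneg _)]
      simp
    simp only [hlin] at ht'
    rw [← ENNReal.ofReal_sum_of_nonneg
      fun τ _ => integral_nonneg fun ω => Nat.cast_nonneg _] at ht'
    have : (b : ℝ≥0∞) * (t : ℝ≥0∞) = ENNReal.ofReal ((b : ℝ) * t) := by
      rw [ENNReal.ofReal_mul (NNReal.coe_nonneg b), ENNReal.ofReal_coe_nnreal, ENNReal.ofReal_natCast]
    rw [this] at ht'
    exact (ENNReal.ofReal_le_ofReal_iff (by positivity)).mp ht'
  choose b hb using hn
  refine ⟨∑ n, α n * b n, ?_⟩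
  filter_upwards [eventually_all.mpr hb] with t ht
  unfold meanBacklog
  rw [Finset.sum_comm, Finset.sum_mul]
  refine Finset.sum_le_sum fun n _ => ?_
  rw [← Finset.mul_sum, mul_assoc]
  exact mul_le_mul_of_nonneg_left (ht n) (hα n)

lemma IsSystem.limsup_le_maxRate [IsFiniteMeasure μ] (hN : 1 ≤ N)
    (hsys : IsSystem μ C A X₀ π Amax) (hst : Stabilizable μ C A X₀) {α : Fin N → ℝ}
    (hα : ∀ n, 0 ≤ α n) :
    limsup (runAvg fun t => ∑ n, α n * meanArrival μ A t n) atTop ≤ maxRate π α := by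
  obtain ⟨I, hI, hst⟩ := hst
  obtain ⟨B, hB⟩ := hsys.exists_bound_meanBacklog hI hst hα
  exact limsup_runAvg_le
    (fun t => Finset.sum_nonneg fun n _ =>
      mul_nonneg (hα n) (integral_nonneg fun ω => Nat.cast_nonneg _))
    (fun t => Finset.sum_nonneg fun n _ =>
      mul_nonneg (hα n) (integral_nonneg fun ω => Nat.cast_nonneg _))
    (maxRate_nonneg hsys.prob_nonneg hN hα) (hsys.meanBacklog_step hI hα) hB

lemma runAvg_sum_mul (α : Fin N → ℝ) (f : ℕ → Fin N → ℝ) (t : ℕ) :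
    runAvg (fun t => ∑ n, α n * f t n) t = ∑ n, α n * runAvg (fun t => f t n) t := by
  simp only [runAvg, Finset.sum_div, Finset.mul_sum]
  rw [Finset.sum_comm]
  exact Finset.sum_congr rfl fun _ _ => Finset.sum_congr rfl fun _ _ => mul_div_assoc _ _ _

lemma limsup_runAvg_sum_mul {α a : Fin N → ℝ} {f : ℕ → Fin N → ℝ}
    (h : ∀ n, Tendsto (runAvg fun t => f t n) atTop (𝓝 (a n))) :
    limsup (runAvg fun t => ∑ n, α n * f t n) atTop = ∑ n, α n * a n := by
  refine Tendsto.limsup_eq ?_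
  rw [funext (runAvg_sum_mul α f)]
  exact tendsto_finsetSum _ fun n _ => (h n).const_mul (α n)

lemma tendsto_runAvg_of_eq {f : ℕ → ℝ} {c : ℝ} (h : ∀ t, 1 ≤ t → f t = c) :
    Tendsto (runAvg f) atTop (𝓝 c) := by
  refine tendsto_const_nhds.congr' ?_
  filter_upwards [eventually_gt_atTop 0] with t ht
  have : (t : ℝ) ≠ 0 := by exact_mod_cast ht.ne'
  rw [runAvg, Finset.sum_congr rfl fun τ hτ => h τ (Finset.mem_Icc.mp hτ).1]
  simp [this]

end MQMS

theorem theorem1 {N K M : ℕ} (hN : 1 ≤ N) (hM : 1 ≤ M)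
    {Ω : Type*} [MeasurableSpace Ω] (μ : Measure Ω) [IsProbabilityMeasure μ]
    (C : ℕ → Ω → MQMS.ChannelState N K M) (A : ℕ → Ω → Fin N → ℕ) (X₀ : Ω → Fin N → ℕ)
    (π : MQMS.ChannelState N K M → ℝ) (Amax : ℝ≥0)
    (hsys : MQMS.IsSystem μ C A X₀ π Amax) :
    -- a set `Vhat` with the required property exists, even inside `V` without zero
    (∃ Vhat : Set (Fin N → ℝ), Vhat ⊆ MQMS.V N M \ {0} ∧ MQMS.GeneratesV M Vhat) ∧
    ∀ Vhat : Set (Fin N → ℝ), MQMS.GeneratesV M Vhat →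
      Vhat.Finite ∧
      -- the necessary conditions for stability
      (MQMS.Stabilizable μ C A X₀ → ∀ α ∈ Vhat,
        -- without assuming that time averages converge
        limsup (MQMS.runAvg fun t => ∑ n, α n * MQMS.meanArrival μ A t n) atTop
          ≤ MQMS.maxRate π α ∧
        -- for the limit of the time averages
        (∀ a : Fin N → ℝ,
          (∀ n, Tendsto (MQMS.runAvg fun t => MQMS.meanArrival μ A t n) atTop (𝓝 (a n))) →
          ∑ n, α n * a n ≤ MQMS.maxRate π α) ∧
        -- for stationary arrivals
        (∀ lam : Fin N → ℝ, (∀ t, 1 ≤ t → ∀ n, MQMS.meanArrival μ A t n = lam n) →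
          ∑ n, α n * lam n ≤ MQMS.maxRate π α)) ∧
      -- these inequalities describe the polytope in the nonnegative orthant
      MQMS.ratePolytope π =
        {x | (∀ n, 0 ≤ x n) ∧ ∀ α ∈ Vhat, ∑ n, α n * x n ≤ MQMS.maxRate π α} ∧
      -- all facets but the coordinate ones are defined by these inequalities
      (MQMS.dim (MQMS.ratePolytope π) = N →
        (∀ F : Set (Fin N → ℝ), MQMS.IsFacet (MQMS.ratePolytope π) F →
          (∃ n, F = {x | x ∈ MQMS.ratePolytope π ∧ x n = 0}) ∨
          ∃ α ∈ Vhat,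
            F = {x | x ∈ MQMS.ratePolytope π ∧ ∑ n, α n * x n = MQMS.maxRate π α}) ∧
        ∀ α : Fin N → ℝ, (∀ n, 0 ≤ α n) → α ∉ MQMS.V N M →
          ¬ MQMS.IsFacet (MQMS.ratePolytope π)
            {x | x ∈ MQMS.ratePolytope π ∧ ∑ n, α n * x n = MQMS.maxRate π α}) := by
  have hπ := hsys.prob_nonneg
  refine ⟨MQMS.exists_generatesV hM, fun Vhat hgen => ?_⟩
  have hfin := MQMS.finite_of_subset_W hgen.subset_W
  have hP := MQMS.ratePolytope_eq hN hM hπ hgen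
  refine ⟨hfin, fun hst α hα => ?_, hP, fun hdim => ⟨fun F hF => ?_, fun α hα hV =>
    MQMS.not_isFacet_of_notMem_V hN hM hπ hdim hα hV⟩⟩
  · have hle := hsys.limsup_le_maxRate hN hst (hgen.nonneg hα)
    refine ⟨hle, fun a ha => ?_, fun lam hlam => ?_⟩
    · rwa [MQMS.limsup_runAvg_sum_mul ha] at hle
    · rwa [MQMS.limsup_runAvg_sum_mul fun n =>
        MQMS.tendsto_runAvg_of_eq fun t ht => hlam t ht n] at hle
  · have := hfin.to_subtype
    -- the constraints `-x_n ≤ 0` and `α x ≤ h(α)` for `α ∈ Vhat`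
    let c : Fin N ⊕ Vhat → Fin N → ℝ := Sum.elim (fun n => -Pi.single n 1) fun α => α
    let d : Fin N ⊕ Vhat → ℝ := Sum.elim (fun _ => 0) fun α => MQMS.maxRate π α
    have hc : ∀ n x, MQMS.pairing (c (Sum.inl n)) x = -x n := by
      intro n x
      simp [c, MQMS.pairing_apply, Pi.single_apply]
    have hPc : MQMS.ratePolytope π = {x | ∀ i, MQMS.pairing (c i) x ≤ d i} := by
      rw [hP]
      ext x
      simp only [Set.mem_ofPred_eq, Sum.forall, hc]
      simp [c, d, MQMS.pairing_apply]
    obtain ⟨i | α, -, hFi⟩ := hF.exists_tight hPc hdim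
    · left
      exact ⟨i, by simpa only [hc, d, Sum.elim_inl, neg_eq_zero] using hFi⟩
    · right
      exact ⟨α, α.2, by simpa only [c, d, Sum.elim_inr, MQMS.pairing_apply] using hFi⟩
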